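/- Conventions. Compact spaces are Hausdorff. Let $k\ge 1$. A $(k+1)$-tuple $\mathcal A=(A_0,\dots,A_k)$ of subsets of a space $X$ is a \emph{$\partial\Delta^k$-tuple} if, for every non-empty $I\subset\{0,\dots,k\}$ with $\bigcap_{i\in I}A_i\ne\emptyset$, the vertices $e_i$ $(i\in I)$ span a simplex of the boundary complex $\partial\Delta^k$ of the $k$-simplex (i.e.\ $A_0\cap\dots\cap A_k=\emptyset$); it is open (closed) if all $A_i$ are. A \emph{$\partial\Delta^k$-neighbourhood} of a tuple $\mathcal B$ is an open $\partial\Delta^k$-tuple $\mathcal U$ with $B_i\subset U_i$ for all $i$; the set $X\setminus\bigcup_i U_i$ is then a \emph{$\partial\Delta^k$-partition} for $\mathcal B$. The dimension $\partial\Delta^k\text{-}\mathrm{Ind}\,X\in\{-1\}\cup\mathrm{Ordinals}\cup\{\infty\}$ of a normal space $X$ is $-1$ iff $X=\emptyset$; for an ordinal $\alpha$, $\partial\Delta^k\text{-}\mathrm{Ind}\,X\le\alpha$ iff every closed $\partial\Delta^k$-tuple of $X$ has a $\partial\Delta^k$-partition $P$ with $\partial\Delta^k\text{-}\mathrm{Ind}\,P<\alpha$;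 for $X\neq\emptyset$ the dimension is the least such $\alpha$, or $\infty$ if there is none. For an open $\partial\Delta^k$-tuple $\mathcal U$, a point $x$ is an \emph{obstruction point} if no $\partial\Delta^k$-neighbourhood $\mathcal V$ of $\mathcal U$ has $x\in\bigcup_i V_i$. The space $X$ has \emph{strength degree $1$} (is strongly dimensional) if $0<\alpha=\partial\Delta^k\text{-}\mathrm{Ind}\,X<\infty$ and there is a closed $\partial\Delta^k$-tuple $\mathcal F$ such that every $\partial\Delta^k$-neighbourhood $\mathcal U$ of $\mathcal F$ with $\partial\Delta^k\text{-}\mathrm{Ind}(X\setminus\bigcup_i U_i)<\alpha$ has an obstruction point. For non-empty compact spaces $X,Y$, let $\mathcal S_X$ be the family of all subsets of $X$ that are finite or homeomorphic to the one-point compactification of the countably infinite discrete space. Let $\mathfrak m\ge\max\{\aleph_0,(wX)^+,(wY)^+,\operatorname{card}\mathcal S_X\}$ ($w$ denotes weight), let $A_{\mathfrak m}$ be the one-point compactification, with point at infinity $\mu$, of the discrete space of cardinality $\mathfrak m$, and let $\varphi\colon A_{\mathfrak m}\setminus\{\mu\}\to\mathcal S_X$ satisfy $\operatorname{card}\varphi^{-1}(S)=\mathfrak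 m$ for every $S\in\mathcal S_X$. Let $\pi_1$ be the quotient map of $A_{\mathfrak m}\times X\times Y$ that collapses each set $\{\mu\}\times\{x\}\times Y$, $x\in X$, to a point. Define $$Z(X,Y)=\pi_1(\{\mu\}\times X\times Y)\cup\bigcup_{\alpha\ne\mu}\pi_1(\{\alpha\}\times\varphi(\alpha)\times Y)$$ with the subspace topology of the quotient space. Theorem. Let $k\ge 1$, and let $X$ and $Y$ be non-empty compact spaces such that $X$ is a Fr\'echet space (every point of the closure of a set is the limit of a sequence in that set). If $X$ has strength degree $1$ with respect to $\partial\Delta^k$ and $\partial\Delta^k\text{-}\mathrm{Ind}\,X=\partial\Delta^k\text{-}\mathrm{Ind}\,Y$, then, for every choice of $\mathfrak m$ and $\varphi$ as above, $$\partial\Delta^k\text{-}\mathrm{Ind}\,Z(X,Y)=\partial\Delta^k\text{-}\mathrm{Ind}\,X+1.$$ -/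

import Mathlib

open Set Topology Cardinal

universe u

namespace FedorchukDim

/-- The simplicial complex `∂Δ^k` with vertices `0, …, k`: all simplices of `Δ^k` except the
`k`-dimensional one. -/
def boundarySimplex (k : ℕ) : PreAbstractSimplicialComplex (Fin (k + 1)) where
  faces := {s | s.Nonempty ∧ s ≠ Finset.univ}
  isRelLowerSet_faces := by
    rintro s ⟨hs, hne⟩
    refine ⟨hs, fun t hts ht => ⟨ht, ?_⟩⟩
    rintro rfl
    exact hne (Finset.univ_subset_iff.mp hts)

section Tuples

variable {k : ℕ} (K : PreAbstractSimplicialComplex (Fin (k + 1))) {X : Type u}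

/-- A `(k+1)`-tuple of subsets of `X` is a `K`-tuple if every (non-empty) set of indices whose
members have a common point spans a simplex of `K`. -/
def IsTuple (A : Fin (k + 1) → Set X) : Prop :=
  ∀ I : Finset (Fin (k + 1)), I.Nonempty → (⋂ i ∈ I, A i).Nonempty → I ∈ K

variable [TopologicalSpace X]

/-- A `K`-tuple consisting of closed sets. -/
def IsClosedTuple (F : Fin (k + 1) → Set X) : Prop :=
  IsTuple K F ∧ ∀ i, IsClosed (F i)

/-- A `K`-tuple consisting of open sets. -/
def IsOpenTuple (U : Fin (k + 1) → Set X) : Prop :=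
  IsTuple K U ∧ ∀ i, IsOpen (U i)

/-- `U` is a `K`-neighbourhood of the tuple `B`. -/
def IsTupleNhd (U B : Fin (k + 1) → Set X) : Prop :=
  IsOpenTuple K U ∧ ∀ i, B i ⊆ U i

/-- The set of `K`-obstruction points for `U`: the points that lie in the union of no
`K`-neighbourhood of `U`. -/
def obstruction (U : Fin (k + 1) → Set X) : Set X :=
  {x | ¬ ∃ V : Fin (k + 1) → Set X, IsTupleNhd K V U ∧ x ∈ ⋃ i, V i}

end Tuples

/-- The partition `X ∖ ⋃ U` corresponding to the tuple `U`. -/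
def partitionOf {k : ℕ} {X : Type u} (U : Fin (k + 1) → Set X) : Set X := (⋃ i, U i)ᶜ

section Dimension

variable {k : ℕ} (K : PreAbstractSimplicialComplex (Fin (k + 1)))

/-- `IndLE K α X` is `K-Ind X ≤ α`, where `α` is an ordinal: every closed `K`-tuple of `X` has a
`K`-partition `P` with `K-Ind P < α`, that is, `P` is empty or `K-Ind P ≤ β` for some `β < α`. -/
def IndLE (α : Ordinal.{u}) (X : Type u) [TopologicalSpace X] : Prop :=
  ∀ F : Fin (k + 1) → Set X, IsClosedTuple K F →
    ∃ U : Fin (k + 1) → Set X, IsTupleNhd K U F ∧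
      (partitionOf U = ∅ ∨ ∃ β, ∃ _ : β < α, IndLE β ↥(partitionOf U))
termination_by α

open Classical in
/-- The inductive dimension `K-Ind X`, an element of `{-1} ∪ Ordinals ∪ {∞}`; here `⊥` stands for
`-1` and `⊤` for `∞`. -/
noncomputable def ind (X : Type u) [TopologicalSpace X] : WithBot (WithTop Ordinal.{u}) :=
  if IsEmpty X then ⊥
  else if ∃ α, IndLE K α X then (((sInf {α | IndLE K α X} : Ordinal.{u}) : WithTop Ordinal.{u}) :
    WithBot (WithTop Ordinal.{u}))
  else ((⊤ : WithTop Ordinal.{u}) : WithBot (WithTop Ordinal.{u}))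

open Classical in
/-- The dimensional strength degree of `X`, equal to `0` or `1`. It can be `1` only when
`0 < K-Ind X < ∞`, and then it is `0` iff every closed `K`-tuple has a `K`-neighbourhood `U`
without obstruction points whose partition has smaller dimension. -/
noncomputable def strength (X : Type u) [TopologicalSpace X] : ℕ :=
  if 0 < ind K X ∧ ind K X < ⊤ ∧
      ¬ ∀ F : Fin (k + 1) → Set X, IsClosedTuple K F →
          ∃ U : Fin (k + 1) → Set X, IsTupleNhd K U F ∧ obstruction K U = ∅ ∧
            ind K ↥(partitionOf U) < ind K X
  then 1 else 0

theorem ind_eq_bot_iff (X : Type u) [TopologicalSpace X] : ind K X = ⊥ ↔ IsEmpty X := by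
  unfold ind
  split_ifs <;> simp_all

theorem ind_le_coe_iff_indLE (α : Ordinal.{u}) (X : Type u) [TopologicalSpace X] :
    ind K X ≤ ((α : WithTop Ordinal.{u}) : WithBot (WithTop Ordinal.{u})) ↔
      IsEmpty X ∨ IndLE K α X := by
  have mono : ∀ {β γ : Ordinal.{u}}, β ≤ γ → IndLE K β X → IndLE K γ X := by
    intro β γ hβγ h
    rw [IndLE] at h ⊢
    intro F hF
    obtain ⟨U, hU, h | ⟨δ, hδ, h⟩⟩ := h F hF
    · exact ⟨U, hU, Or.inl h⟩
    · exact ⟨U, hU, Or.inr ⟨δ, hδ.trans_le hβγ, h⟩⟩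
  unfold ind
  split_ifs with h1 h2
  · simp [h1]
  · simp only [h1, false_or, WithBot.coe_le_coe, WithTop.coe_le_coe]
    exact ⟨fun h => mono h (csInf_mem (s := {α | IndLE K α X}) h2), fun h => csInf_le' h⟩
  · simp only [h1, false_or, WithBot.coe_le_coe, top_le_iff, WithTop.coe_ne_top, false_iff]
    exact fun h => h2 ⟨α, h⟩

/-- The recursive characterisation of `K-Ind`. -/
theorem ind_le_coe_iff (α : Ordinal.{u}) (X : Type u) [TopologicalSpace X] :
    ind K X ≤ ((α : WithTop Ordinal.{u}) : WithBot (WithTop Ordinal.{u})) ↔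
      ∀ F : Fin (k + 1) → Set X, IsClosedTuple K F →
        ∃ U : Fin (k + 1) → Set X, IsTupleNhd K U F ∧
          ind K ↥(partitionOf U) < ((α : WithTop Ordinal.{u}) : WithBot (WithTop Ordinal.{u})) := by
  have key : ∀ P : Set X,
      ind K ↥P < ((α : WithTop Ordinal.{u}) : WithBot (WithTop Ordinal.{u})) ↔
        (P = ∅ ∨ ∃ β, ∃ _ : β < α, IndLE K β ↥P) := by
    intro P
    rw [← Set.isEmpty_coe_sort]
    constructor
    · intro h
      by_cases hP : IsEmpty ↥P
      · exact Or.inl hP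
      · right
        unfold ind at h
        rw [if_neg hP] at h
        split_ifs at h with h2
        · rw [WithBot.coe_lt_coe, WithTop.coe_lt_coe] at h
          exact ⟨_, h, csInf_mem (s := {α | IndLE K α ↥P}) h2⟩
        · rw [WithBot.coe_lt_coe] at h
          exact absurd h not_top_lt
    · rintro (h | ⟨β, hβ, h⟩)
      · rw [(ind_eq_bot_iff K _).2 h]
        exact WithBot.bot_lt_coe _
      · refine ((ind_le_coe_iff_indLE K β _).2 (Or.inr h)).trans_lt ?_
        rwa [WithBot.coe_lt_coe, WithTop.coe_lt_coe]
  simp only [key]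
  rw [ind_le_coe_iff_indLE, IndLE]
  refine or_iff_right_of_imp fun hX F hF => ⟨F, ⟨⟨hF.1, fun i => ?_⟩, fun i => subset_rfl⟩,
    Or.inl (Set.eq_empty_of_isEmpty _)⟩
  rw [Set.eq_empty_of_isEmpty (F i)]
  exact isOpen_empty

end Dimension

section Plank

/-- The weight of a topological space: the least cardinality of a base. -/
noncomputable def weight (X : Type u) [TopologicalSpace X] : Cardinal.{u} :=
  sInf {c | ∃ B : Set (Set X), TopologicalSpace.IsTopologicalBasis B ∧ #B = c}

/-- The family `𝒮_X` of all subsets of `X` that are finite or homeomorphic to the one-point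
compactification of the countable discrete space. -/
def smallSets (X : Type u) [TopologicalSpace X] : Set (Set X) :=
  {S | S.Finite ∨ Nonempty (↥S ≃ₜ OnePoint ℕ)}

variable (D X Y : Type u) [TopologicalSpace D] [TopologicalSpace X] [TopologicalSpace Y]

/-- The relation on `OnePoint D × X × Y` that identifies `(∞, x, y)` and `(∞, x, y')` for all
`x`, `y`, `y'`, and nothing else. -/
def plankSetoid : Setoid (OnePoint D × X × Y) where
  r p q := p = q ∨ (p.1 = OnePoint.infty ∧ q.1 = OnePoint.infty ∧ p.2.1 = q.2.1)
  iseqv :=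
    { refl := fun _ => Or.inl rfl
      symm := by
        rintro p q (rfl | ⟨hp, hq, h⟩)
        · exact Or.inl rfl
        · exact Or.inr ⟨hq, hp, h.symm⟩
      trans := by
        rintro p q r (rfl | ⟨hp, hq, h⟩) (rfl | ⟨hq', hr, h'⟩)
        · exact Or.inl rfl
        · exact Or.inr ⟨hq', hr, h'⟩
        · exact Or.inr ⟨hp, hq, h⟩
        · exact Or.inr ⟨hp, hr, h.trans h'⟩ }

/-- The quotient space `N` of `OnePoint D × X × Y`, with the quotient topology. -/
abbrev PlankQuotient : Type u := Quotient (plankSetoid D X Y)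

variable {D X}

/-- The layer `H(α)` of the plank over `α ∈ OnePoint D`. -/
def layer (φ : D → ↥(smallSets X)) : OnePoint D → Set (PlankQuotient D X Y)
  | none => Quotient.mk (plankSetoid D X Y) '' {p | p.1 = OnePoint.infty}
  | some d => Quotient.mk (plankSetoid D X Y) ''
      {p | p.1 = (d : OnePoint D) ∧ p.2.1 ∈ (φ d : Set X)}

/-- The space `Z(X, Y) = ⋃ α, H(α)`, a subspace of the quotient space. -/
abbrev Plank (φ : D → ↥(smallSets X)) : Type u := ↥(⋃ α : OnePoint D, layer Y φ α)

end Plank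

end FedorchukDim

/-!
Write `α` for the common dimension of `X` and `Y`, and `Z` for the plank. The index
`π : Z → OnePoint D` has the fibre `X` over `∞` and the clopen fibres `φ d × Y` over the points `d`
of `D`, and the projection `r : Z → X` is a retraction. By compactness, a neighbourhood of a
closed tuple over `∞` is good over all but finitely many `d` (`exists_nhd_eq_off_finite`).

*Upper bound.* Each `φ d` is a zero-dimensional compact space, so the fibres over `D` have dimension
at most `α` (`ind_prod_le`). Given a closed tuple of `Z`, take a neighbourhood of its trace on `X`
whose partition has dimension less than `α`, and pull it back along `r`, with corrections over
finitely many `d`. The resulting partition `P` has dimension at most `α`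
(`ind_le_of_ind_fiber_infty_lt`): its part over `∞` has dimension less than `α`, so there one may
take any neighbourhood whose closures form a tuple. Such a neighbourhood has no obstruction points,
hence extends over the zero-dimensional sets `φ d` to a tuple covering them. What remains is a
closed subset of the part of `P` over `∞` together with finitely many clopen pieces of dimension
less than `α`. Hence the dimension of `Z` is at most `α + 1` (`ind_le_add_one`).

*Lower bound.* Suppose that a closed tuple of `X` witnessing strength degree one, viewed in `Z`, has
a neighbourhood `U` whose partition has dimension less than `α`. The trace of `U` on `X` has an
obstruction point `x`, and `x` is a limit of sequences in the intersections of all members but one.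
Let `S` consist of `x` and these sequences. Since `D` is uncountable, there is `d` with `φ d = S`
such that the products of the terms of the sequences with `Y` lie, over `d`, in the same members of
`U` as the terms themselves. Then `{d} × {x} × Y` is disjoint from `U`, so the partition contains a
copy of `Y`, of dimension `α`, a contradiction (`not_ind_le_of_strength_eq_one`).
-/

namespace FedorchukDim

/-! ### Tuples over the boundary of a simplex -/

section Tuples

variable {k : ℕ} {X Y : Type u}

theorem isTuple_boundarySimplex_iff {A : Fin (k + 1) → Set X} :
    IsTuple (boundarySimplex k) A ↔ ∀ x, ∃ i, x ∉ A i := by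
  constructor
  · intro h x
    by_contra! hx
    exact (h Finset.univ Finset.univ_nonempty ⟨x, by simpa using hx⟩).2 rfl
  · rintro h I hI ⟨x, hx⟩
    refine ⟨hI, ?_⟩
    rintro rfl
    obtain ⟨i, hi⟩ := h x
    exact hi (by simpa using mem_iInter.1 hx i)

theorem IsTuple.preimage {A : Fin (k + 1) → Set Y} (h : IsTuple (boundarySimplex k) A)
    (f : X → Y) : IsTuple (boundarySimplex k) fun i => f ⁻¹' A i := by
  rw [isTuple_boundarySimplex_iff] at h ⊢
  exact fun x => h (f x)

theorem IsTuple.image {A : Fin (k + 1) → Set X} (h : IsTuple (boundarySimplex k) A)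
    {f : X → Y} (hf : Function.Injective f) :
    IsTuple (boundarySimplex k) fun i => f '' A i := by
  rw [isTuple_boundarySimplex_iff] at h ⊢
  intro y
  by_cases hy : y ∈ range f
  · obtain ⟨x, rfl⟩ := hy
    simpa [hf.eq_iff] using h x
  · exact ⟨0, fun ⟨x, _, hx⟩ => hy ⟨x, hx⟩⟩

variable [TopologicalSpace X] [TopologicalSpace Y]

theorem IsClosedTuple.preimage {A : Fin (k + 1) → Set Y}
    (h : IsClosedTuple (boundarySimplex k) A) {f : X → Y} (hf : Continuous f) :
    IsClosedTuple (boundarySimplex k) fun i => f ⁻¹' A i :=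
  ⟨h.1.preimage f, fun i => (h.2 i).preimage hf⟩

theorem IsClosedTuple.image {A : Fin (k + 1) → Set X}
    (h : IsClosedTuple (boundarySimplex k) A) {f : X → Y} (hf : IsClosedEmbedding f) :
    IsClosedTuple (boundarySimplex k) fun i => f '' A i :=
  ⟨h.1.image hf.injective, fun i => hf.isClosedMap _ (h.2 i)⟩

theorem IsTupleNhd.preimage {U B : Fin (k + 1) → Set Y} {f : X → Y} (hf : Continuous f)
    (h : IsTupleNhd (boundarySimplex k) U B) :
    IsTupleNhd (boundarySimplex k) (fun i => f ⁻¹' U i) (fun i => f ⁻¹' B i) :=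
  ⟨⟨h.1.1.preimage f, fun i => (h.1.2 i).preimage hf⟩, fun i => preimage_mono (h.2 i)⟩

/-- In a normal space every closed tuple has a neighbourhood whose closures still form a tuple. -/
theorem IsClosedTuple.exists_nhd_closure [NormalSpace X] {F : Fin (k + 1) → Set X}
    (hF : IsClosedTuple (boundarySimplex k) F) :
    ∃ V : Fin (k + 1) → Set X, (∀ i, IsOpen (V i)) ∧ (∀ i, F i ⊆ V i) ∧
      ∀ x, ∃ i, x ∉ closure (V i) := by
  have hF1 := isTuple_boundarySimplex_iff.1 hF.1
  obtain ⟨v, hv, hvo, hvF⟩ := exists_iUnion_eq_closure_subset (u := fun i => (F i)ᶜ)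
    (fun i => (hF.2 i).isOpen_compl) (fun _ => toFinite _)
    (eq_univ_of_forall fun x => mem_iUnion.2 (hF1 x))
  refine ⟨fun i => (closure (v i))ᶜ, fun i => isClosed_closure.isOpen_compl,
    fun i => subset_compl_comm.1 (hvF i), fun x => ?_⟩
  obtain ⟨i, hi⟩ := mem_iUnion.1 (hv.symm ▸ mem_univ x)
  refine ⟨i, fun hx => ?_⟩
  have : closure (closure (v i))ᶜ ⊆ (v i)ᶜ :=
    closure_minimal (compl_subset_compl.2 subset_closure) (hvo i).isClosed_compl
  exact this hx hi

/-- Near an obstruction point of an open tuple, each intersection of all members but one is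
non-empty: otherwise a neighbourhood of the point could be added
to the remaining member. -/
theorem mem_closure_of_mem_obstruction {U : Fin (k + 1) → Set X}
    (hU : ∀ i, IsOpen (U i)) (hU' : IsTuple (boundarySimplex k) U) {x : X}
    (hx : x ∈ obstruction (boundarySimplex k) U) (i : Fin (k + 1)) :
    x ∈ closure {y | ∀ j ≠ i, y ∈ U j} := by
  classical
  by_contra hc
  refine hx ⟨fun j => if j = i then U j ∪ (closure {y | ∀ j ≠ i, y ∈ U j})ᶜ else U j,
    ⟨⟨?_, fun j => ?_⟩, fun j => ?_⟩, mem_iUnion.2 ⟨i, by simp [hc]⟩⟩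
  · rw [isTuple_boundarySimplex_iff] at hU' ⊢
    intro y
    by_contra! hy
    have h1 : ∀ j ≠ i, y ∈ U j := fun j hj => by simpa [hj] using hy j
    have h2 : y ∈ U i := by
      have := hy i
      simp only [if_true] at this
      exact this.resolve_right fun h => h (subset_closure h1)
    obtain ⟨j, hj⟩ := hU' y
    by_cases hji : j = i
    · exact hj (hji ▸ h2)
    · exact hj (h1 j hji)
  · dsimp only
    split_ifs
    · exact (hU j).union isClosed_closure.isOpen_compl
    · exact hU j
  · dsimp only
    split_ifs
    · exact subset_union_left
    · exact subset_rfl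

end Tuples

/-! ### Closed subspaces, clopen sums and products with zero-dimensional spaces -/

section Dimension

variable {k : ℕ} {X Y : Type u} [TopologicalSpace X] [TopologicalSpace Y]

local notation "Ind" => ind (boundarySimplex k)

theorem ind_of_isEmpty [h : IsEmpty X] : Ind X = ⊥ := (ind_eq_bot_iff _ X).2 h

/-- Monotonicity on closed subspaces; in particular `ind` is a topological invariant. -/
theorem _root_.Topology.IsClosedEmbedding.ind_le {f : X → Y} (hf : IsClosedEmbedding f) :
    Ind X ≤ Ind Y := by
  have key : ∀ a : WithBot (WithTop Ordinal.{u}), ∀ (X Y : Type u) [TopologicalSpace X]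
      [TopologicalSpace Y] (f : X → Y), IsClosedEmbedding f → Ind Y ≤ a → Ind X ≤ a := by
    intro a
    induction a using WellFoundedLT.induction with
    | ind a IH =>
    intro X Y _ _ f hf hY
    rcases a with _ | _ | α
    · have : IsEmpty Y := (ind_eq_bot_iff _ _).1 (le_bot_iff.1 hY)
      have : IsEmpty X := Function.isEmpty f
      rw [ind_of_isEmpty]
      exact bot_le
    · exact le_top
    · refine (ind_le_coe_iff _ α X).2 fun F hF => ?_
      obtain ⟨U, hU, hP⟩ := (ind_le_coe_iff _ α Y).1 hY _ (hF.image hf)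
      have hU' := hU.preimage hf.continuous
      refine ⟨fun i => f ⁻¹' U i,
        ⟨hU'.1, fun i => (subset_preimage_image f _).trans (hU'.2 i)⟩, ?_⟩
      have he : partitionOf (fun i => f ⁻¹' U i) = f ⁻¹' partitionOf U := by
        ext; simp [partitionOf]
      rw [he]
      exact (IH _ hP _ _ _ (hf.restrictPreimage (partitionOf U)) le_rfl).trans_lt hP
  exact key _ X Y f hf le_rfl

theorem _root_.Homeomorph.ind_eq (e : X ≃ₜ Y) : Ind X = Ind Y :=
  le_antisymm e.isClosedEmbedding.ind_le e.symm.isClosedEmbedding.ind_le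

theorem ind_mono_of_isClosed {A B : Set X} (hA : IsClosed A) (hAB : A ⊆ B) :
    Ind ↥A ≤ Ind ↥B :=
  (IsClosedEmbedding.inclusion hAB (hA.preimage continuous_subtype_val)).ind_le

/-- A space with finitely many clopen pieces, the fibres of a locally constant map, has dimension
at most that of its largest piece. -/
theorem ind_le_of_isLocallyConstant {ι : Type*} [Finite ι] {c : X → ι} (hc : IsLocallyConstant c)
    {a : WithBot (WithTop Ordinal.{u})} (h : ∀ i, Ind ↥(c ⁻¹' {i}) ≤ a) : Ind X ≤ a := by
  cases nonempty_fintype ι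
  have key : ∀ a : WithBot (WithTop Ordinal.{u}), ∀ (X : Type u) [TopologicalSpace X]
      (c : X → ι), IsLocallyConstant c → (∀ i, Ind ↥(c ⁻¹' {i}) ≤ a) → Ind X ≤ a := by
    intro a
    induction a using WellFoundedLT.induction with
    | ind a IH =>
    intro X _ c hc h
    rcases a with _ | _ | α
    · have : IsEmpty X := ⟨fun x =>
        ((ind_eq_bot_iff _ _).1 (le_bot_iff.1 (h (c x)))).false ⟨x, rfl⟩⟩
      rw [ind_of_isEmpty]
      exact bot_le
    · exact le_top
    refine (ind_le_coe_iff _ α X).2 fun F hF => ?_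
    choose U hU hP using fun i => (ind_le_coe_iff _ α _).1 (h i) _
      (hF.preimage (continuous_subtype_val (p := fun x => x ∈ c ⁻¹' {i})))
    let V : Fin (k + 1) → Set X := fun j => ⋃ i, (↑) '' U i j
    have hV : ∀ x j, x ∈ V j ↔ (⟨x, rfl⟩ : ↥(c ⁻¹' {c x})) ∈ U (c x) j := by
      intro x j
      simp only [V, mem_iUnion, mem_image]
      constructor
      · rintro ⟨i, ⟨y, rfl⟩, hy, rfl⟩
        exact hy
      · exact fun hx => ⟨_, _, hx, rfl⟩
    refine ⟨V, ⟨⟨?_, fun j => ?_⟩, fun j x hx => ?_⟩, ?_⟩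
    · rw [isTuple_boundarySimplex_iff]
      intro x
      simp only [hV]
      exact isTuple_boundarySimplex_iff.1 (hU (c x)).1.1 _
    · exact isOpen_iUnion fun i => (hc.isOpen_fiber i).isOpenMap_subtype_val _ ((hU i).1.2 j)
    · exact (hV x j).2 ((hU (c x)).2 j hx)
    · have hlt : Finset.univ.sup (fun i => Ind ↥(partitionOf (U i))) <
          ((α : WithTop Ordinal.{u}) : WithBot (WithTop Ordinal.{u})) :=
        (Finset.sup_lt_iff (WithBot.bot_lt_coe _)).2 fun i _ => hP i
      refine (IH _ hlt ↥(partitionOf V) (fun x => c x) (hc.comp_continuous continuous_subtype_val)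
        fun i => ?_).trans_lt hlt
      refine le_trans ?_ (Finset.le_sup (f := fun i => Ind ↥(partitionOf (U i)))
        (Finset.mem_univ i))
      have hm : ∀ z : ↥((fun x : ↥(partitionOf V) => c x) ⁻¹' {i}),
          (⟨z.1.1, z.2⟩ : ↥(c ⁻¹' {i})) ∈ partitionOf (U i) := by
        rintro ⟨⟨x, hx⟩, rfl⟩
        simp only [partitionOf, mem_compl_iff, mem_iUnion, hV] at hx ⊢
        exact hx
      have hm' : ∀ y : ↥(partitionOf (U i)), y.1.1 ∈ partitionOf V := by
        rintro ⟨⟨x, rfl⟩, hx⟩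
        simp only [partitionOf, mem_compl_iff, mem_iUnion, hV] at hx ⊢
        exact hx
      let e : ↥((fun x : ↥(partitionOf V) => c x) ⁻¹' {i}) ≃ₜ ↥(partitionOf (U i)) :=
        { toFun := fun z => ⟨⟨z.1.1, z.2⟩, hm z⟩
          invFun := fun y => ⟨⟨y.1.1, hm' y⟩, y.1.2⟩
          left_inv := fun _ => rfl
          right_inv := fun _ => rfl
          continuous_toFun := by fun_prop
          continuous_invFun := by fun_prop }
      exact e.ind_eq.le
  exact key a X c hc h

theorem ind_lt_of_isLocallyConstant {ι : Type*} [Finite ι] {c : X → ι} (hc : IsLocallyConstant c)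
    {a : WithBot (WithTop Ordinal.{u})} (ha : ⊥ < a) (h : ∀ i, Ind ↥(c ⁻¹' {i}) < a) :
    Ind X < a := by
  cases nonempty_fintype ι
  exact (ind_le_of_isLocallyConstant hc fun i => Finset.le_sup
    (f := fun i => Ind ↥(c ⁻¹' {i})) (Finset.mem_univ i)).trans_lt
      ((Finset.sup_lt_iff ha).2 fun i _ => h i)

end Dimension

/-- An open cover of a zero-dimensional compact space admits a locally constant choice of a member
containing each given point. -/
theorem exists_isLocallyConstant_mem {S : Type*} [TopologicalSpace S] [CompactSpace S] [T2Space S]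
    [TotallyDisconnectedSpace S] {ι : Type*} {O : ι → Set S} (hO : ∀ i, IsOpen (O i))
    (h : ∀ s, ∃ i, s ∈ O i) : ∃ c : S → ι, IsLocallyConstant c ∧ ∀ s, s ∈ O (c s) := by
  obtain ⟨n, W, hW, hWu, hWd⟩ :=
    TopologicalSpace.IsOpenCover.exists_finite_nonempty_disjoint_clopen_cover
      (U := fun i => (⟨O i, hO i⟩ : TopologicalSpace.Opens S))
      (.of_sets hO (eq_univ_of_forall fun s => mem_iUnion.2 (h s)))
  choose i hi using fun j => (hW j).2
  choose j hj using fun s => mem_iUnion.1 (hWu (mem_univ s))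
  refine ⟨fun s => i (j s), ?_, fun s => hi _ (hj s)⟩
  refine (IsLocallyConstant.iff_exists_open _).2 fun s => ⟨W (j s), (W (j s)).isOpen, hj s, ?_⟩
  intro t ht
  have : j t = j s := by
    by_contra hne
    exact Set.disjoint_left.1 (TopologicalSpace.Clopens.coe_disjoint.2 (hWd hne)) (hj t) ht
  rw [this]

section Product

variable {k : ℕ} {X Y : Type u} [TopologicalSpace X] [TopologicalSpace Y]

local notation "Ind" => ind (boundarySimplex k)

/-- Multiplying a compact space by a zero-dimensional compact space does not raise its
dimension. -/
theorem ind_prod_le [CompactSpace X] [T2Space X] [TotallyDisconnectedSpace X] [CompactSpace Y] :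
    Ind (X × Y) ≤ Ind Y := by
  have key : ∀ a : WithBot (WithTop Ordinal.{u}), ∀ (Y : Type u) [TopologicalSpace Y]
      [CompactSpace Y], Ind Y ≤ a → Ind (X × Y) ≤ a := by
    intro a
    induction a using WellFoundedLT.induction with
    | ind a IH =>
    intro Y _ _ hY
    rcases a with _ | _ | α
    · have : IsEmpty Y := (ind_eq_bot_iff _ _).1 (le_bot_iff.1 hY)
      rw [ind_of_isEmpty]
      exact bot_le
    · exact le_top
    refine (ind_le_coe_iff _ α (X × Y)).2 fun F hF => ?_
    choose U hU hP using fun s : X => (ind_le_coe_iff _ α Y).1 hY _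
      (hF.preimage (f := fun y => (s, y)) (by fun_prop))
    -- by the tube lemma, the neighbourhood found over `s` is good over all points near `s`
    have tube : ∀ s : X, ∃ O : Set X, IsOpen O ∧ s ∈ O ∧
        ∀ t ∈ O, ∀ y i, (t, y) ∈ F i → y ∈ U s i := by
      intro s
      have ho : IsOpen (⋂ i, ((F i)ᶜ ∪ Prod.snd ⁻¹' U s i : Set (X × Y))) :=
        isOpen_iInter_of_finite fun i =>
          (hF.2 i).isOpen_compl.union (((hU s).1.2 i).preimage continuous_snd)
      obtain ⟨u, v, hu, -, hsu, hv, huv⟩ := generalized_tube_lemma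
        (isCompact_singleton (x := s)) (isCompact_univ (X := Y)) ho (by
          rintro ⟨t, y⟩ ⟨rfl, -⟩
          refine mem_iInter.2 fun i => ?_
          by_cases hy : (t, y) ∈ F i
          · exact Or.inr ((hU t).2 i hy)
          · exact Or.inl hy)
      refine ⟨u, hu, hsu rfl, fun t ht y i hy => ?_⟩
      exact (mem_iInter.1 (huv (mk_mem_prod ht (hv (mem_univ y)))) i).resolve_left fun h => h hy
    choose O hO hsO hOU using tube
    obtain ⟨c, hc, hcO⟩ := exists_isLocallyConstant_mem hO fun s => ⟨s, hsO s⟩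
    let V : Fin (k + 1) → Set (X × Y) := fun i => {p | p.2 ∈ U (c p.1) i}
    refine ⟨V, ⟨⟨?_, fun i => ?_⟩, fun i p hp => hOU _ _ (hcO p.1) _ _ hp⟩, ?_⟩
    · rw [isTuple_boundarySimplex_iff]
      exact fun p => isTuple_boundarySimplex_iff.1 (hU (c p.1)).1.1 p.2
    · have : V i = ⋃ s, (c ⁻¹' {s}) ×ˢ U s i := by
        ext p
        simp [V]
      rw [this]
      exact isOpen_iUnion fun s => (hc.isOpen_fiber s).prod ((hU s).1.2 i)
    · have : Finite (range c) := hc.range_finite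
      have hc' : IsLocallyConstant (rangeFactorization c) :=
        IsLocallyConstant.iff_exists_open _ |>.2 fun s => ⟨c ⁻¹' {c s}, hc.isOpen_fiber _, rfl,
          fun t ht => Subtype.ext ht⟩
      refine ind_lt_of_isLocallyConstant (c := fun p : ↥(partitionOf V) => rangeFactorization c p.1.1)
        (hc'.comp_continuous (by fun_prop)) (WithBot.bot_lt_coe _) fun ⟨s, hs⟩ => ?_
      have hcl : IsClosed (partitionOf (U s)) :=
        (isOpen_iUnion fun i => (hU s).1.2 i).isClosed_compl
      have : CompactSpace ↥(partitionOf (U s)) := isCompact_iff_compactSpace.1 hcl.isCompact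
      refine lt_of_le_of_lt ?_ ((IH _ (hP s) _ le_rfl).trans_lt (hP s))
      have hm : ∀ z : ↥((fun p : ↥(partitionOf V) => rangeFactorization c p.1.1) ⁻¹' {⟨s, hs⟩}),
          c z.1.1.1 = s ∧ z.1.1.2 ∈ partitionOf (U s) := by
        rintro ⟨⟨p, hp⟩, hz⟩
        have hz' : c p.1 = s := congrArg Subtype.val hz
        refine ⟨hz', ?_⟩
        simpa [partitionOf, V, hz'] using hp
      refine IsClosedEmbedding.ind_le (f := fun z => (z.1.1.1, ⟨z.1.1.2, (hm z).2⟩)) ?_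
      have hi : IsInducing (fun z : ↥((fun p : ↥(partitionOf V) => rangeFactorization c p.1.1) ⁻¹'
          {⟨s, hs⟩}) => ((z.1.1.1, ⟨z.1.1.2, (hm z).2⟩) : X × ↥(partitionOf (U s)))) := by
        refine IsInducing.of_comp (by fun_prop) (g := fun q => ((q.1, q.2.1) : X × Y)) (by fun_prop)
          ?_
        exact IsInducing.subtypeVal.comp IsInducing.subtypeVal
      refine ⟨⟨hi, ?_⟩, ?_⟩
      · rintro ⟨⟨⟨x, y⟩, _⟩, _⟩ ⟨⟨⟨x', y'⟩, _⟩, _⟩ h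
        simpa using h
      · have : range (fun z : ↥((fun p : ↥(partitionOf V) => rangeFactorization c p.1.1) ⁻¹'
          {⟨s, hs⟩}) => ((z.1.1.1, ⟨z.1.1.2, (hm z).2⟩) : X × ↥(partitionOf (U s)))) =
            Prod.fst ⁻¹' (c ⁻¹' {s}) := by
          ext ⟨x, y, hy⟩
          constructor
          · rintro ⟨z, hz⟩
            have := (hm z).1
            simp only [Prod.mk.injEq] at hz
            rw [hz.1] at this
            exact this
          · intro (hx : c x = s)
            refine ⟨⟨⟨(x, y), ?_⟩, Subtype.ext hx⟩, rfl⟩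
            simpa [partitionOf, V, hx] using hy
        rw [this]
        exact (hc.isClosed_fiber s).preimage continuous_fst
  exact key _ Y le_rfl

end Product
/-! ### Spaces fibred over the one-point compactification of a discrete space -/

section UpperBound

variable {k : ℕ} {X Z D : Type u} [TopologicalSpace X] [TopologicalSpace Z]
  [CompactSpace Z] [TopologicalSpace D] [DiscreteTopology D]
  {π : Z → OnePoint D} {r : Z → X}

local notation "Ind" => ind (boundarySimplex k)

theorem isOpen_singleton_coe_onePoint (d : D) : IsOpen ({(d : OnePoint D)} : Set (OnePoint D)) := by
  simpa using OnePoint.isOpen_image_coe.2 (isOpen_discrete ({d} : Set D))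

theorem finite_setOf_coe_mem_image (hπ : Continuous π) {C : Set Z} (hC : IsClosed C)
    (h : ∀ z ∈ C, π z ≠ OnePoint.infty) : {d : D | ∃ z ∈ C, π z = d}.Finite := by
  have h1 : IsCompact (π '' C) := hC.isCompact.image hπ
  have h2 : OnePoint.infty ∉ π '' C := by
    rintro ⟨z, hz, hz'⟩
    exact h z hz hz'
  have h3 := ((OnePoint.isClosed_iff_of_notMem h2).1 h1.isClosed).2
  exact isCompact_iff_finite.1 h3

/-- An open tuple that surrounds a closed tuple over `∞` surrounds it over all but finitely many
points `d`; over these finitely many clopen fibres it can be replaced by neighbourhoods with small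
partitions. -/
theorem exists_nhd_eq_off_finite (hπ : Continuous π) {α : Ordinal.{u}}
    (hfib : ∀ d : D, Ind ↥(π ⁻¹' {(d : OnePoint D)}) ≤
      ((α : WithTop Ordinal.{u}) : WithBot (WithTop Ordinal.{u})))
    {F V : Fin (k + 1) → Set Z} (hF : IsClosedTuple (boundarySimplex k) F)
    (hV : IsOpenTuple (boundarySimplex k) V)
    (hFV : ∀ z, π z = OnePoint.infty → ∀ i, z ∈ F i → z ∈ V i) :
    ∃ U : Fin (k + 1) → Set Z, IsTupleNhd (boundarySimplex k) U F ∧ ∃ E : Set D, E.Finite ∧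
      (∀ z, (∀ d ∈ E, π z ≠ d) → ∀ i, z ∈ U i ↔ z ∈ V i) ∧
      ∀ d ∈ E, Ind ↥(partitionOf U ∩ π ⁻¹' {(d : OnePoint D)}) <
        ((α : WithTop Ordinal.{u}) : WithBot (WithTop Ordinal.{u})) := by
  choose T hT hP using fun d => (ind_le_coe_iff _ α _).1 (hfib d) _
    (hF.preimage (continuous_subtype_val (p := fun z => z ∈ π ⁻¹' {(d : OnePoint D)})))
  let E : Set D := ⋃ i, {d | ∃ z ∈ F i ∩ (V i)ᶜ, π z = d}
  have hE : E.Finite := finite_iUnion fun i => finite_setOf_coe_mem_image hπ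
    ((hF.2 i).inter (hV.2 i).isClosed_compl) fun z hz hz' => hz.2 (hFV z hz' i hz.1)
  let U : Fin (k + 1) → Set Z := fun i =>
    (V i ∩ π ⁻¹' ((↑) '' E)ᶜ) ∪ ⋃ d ∈ E, (↑) '' T d i
  have hoff : ∀ z, (∀ d ∈ E, π z ≠ d) → ∀ i, z ∈ U i ↔ z ∈ V i := by
    intro z hz i
    constructor
    · rintro (h | h)
      · exact h.1
      · simp only [mem_iUnion, mem_image] at h
        obtain ⟨d, hd, y, -, rfl⟩ := h
        exact absurd y.2 (hz d hd)
    · exact fun h => Or.inl ⟨h, fun ⟨d, hd, hd'⟩ => hz d hd hd'.symm⟩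
  have hon : ∀ d ∈ E, ∀ z, ∀ hz : π z = d, ∀ i, z ∈ U i ↔
      (⟨z, hz⟩ : ↥(π ⁻¹' {(d : OnePoint D)})) ∈ T d i := by
    intro d hd z hz i
    constructor
    · rintro (h | h)
      · exact absurd ⟨d, hd, hz.symm⟩ h.2
      · simp only [mem_iUnion, mem_image] at h
        obtain ⟨d', hd', y, hy, rfl⟩ := h
        obtain rfl : d' = d := OnePoint.coe_injective (y.2.symm.trans hz)
        exact hy
    · exact fun h => Or.inr (mem_biUnion hd ⟨_, h, rfl⟩)
  have hcases : ∀ z, (∀ d ∈ E, π z ≠ d) ∨ ∃ d ∈ E, π z = d := by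
    intro z
    by_cases h : ∃ d ∈ E, π z = d
    · exact Or.inr h
    · exact Or.inl (by simpa using h)
  refine ⟨U, ⟨⟨?_, fun i => ?_⟩, fun i z hz => ?_⟩, E, hE, hoff, fun d hd => ?_⟩
  · rw [isTuple_boundarySimplex_iff]
    intro z
    rcases hcases z with h | ⟨d, hd, h⟩
    · simp only [hoff z h]
      exact isTuple_boundarySimplex_iff.1 hV.1 z
    · simp only [hon d hd z h]
      exact isTuple_boundarySimplex_iff.1 (hT d).1.1 _
  · refine ((hV.2 i).inter (IsOpen.preimage hπ (IsClosed.isOpen_compl (self := ?_)))).union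
      (isOpen_biUnion fun d _ => ?_)
    · exact (hE.image _).isClosed
    · exact ((isOpen_singleton_coe_onePoint d).preimage hπ).isOpenMap_subtype_val _ ((hT d).1.2 i)
  · rcases hcases z with h | ⟨d, hd, h⟩
    · refine (hoff z h i).2 (by_contra fun hzV => ?_)
      cases hp : π z with
      | infty => exact hzV (hFV z hp i hz)
      | coe d => exact h d (mem_iUnion.2 ⟨i, z, ⟨hz, hzV⟩, hp⟩) hp
    · exact (hon d hd z h i).2 ((hT d).2 i hz)
  · have h1 : ∀ z : ↥(partitionOf U ∩ π ⁻¹' {(d : OnePoint D)}),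
        (⟨z.1, z.2.2⟩ : ↥(π ⁻¹' {(d : OnePoint D)})) ∈ partitionOf (T d) := by
      rintro ⟨z, hz, hzd⟩
      simpa [partitionOf, hon d hd z hzd] using hz
    have h2 : ∀ z : ↥(partitionOf (T d)), z.1.1 ∈ partitionOf U := by
      rintro ⟨⟨z, hzd⟩, hz⟩
      simpa [partitionOf, hon d hd z hzd] using hz
    let e : ↥(partitionOf U ∩ π ⁻¹' {(d : OnePoint D)}) ≃ₜ ↥(partitionOf (T d)) :=
      { toFun := fun z => ⟨⟨z.1, z.2.2⟩, h1 z⟩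
        invFun := fun z => ⟨z.1.1, h2 z, z.1.2⟩
        left_inv := fun _ => rfl
        right_inv := fun _ => rfl
        continuous_toFun := by fun_prop
        continuous_invFun := by fun_prop }
    exact e.ind_eq.trans_lt (hP d)

variable [T2Space X]

theorem isClosedEmbedding_restrict_fiber_infty (hπ : Continuous π) (hr : Continuous r)
    (hinj : InjOn r (π ⁻¹' {OnePoint.infty})) :
    IsClosedEmbedding fun z : ↥(π ⁻¹' {(OnePoint.infty : OnePoint D)}) => r z :=
  have : CompactSpace ↥(π ⁻¹' {(OnePoint.infty : OnePoint D)}) :=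
    isCompact_iff_compactSpace.1 (isClosed_singleton.preimage hπ).isCompact
  (hr.comp continuous_subtype_val).isClosedEmbedding hinj.injective

theorem isClosedTuple_image_fiber_infty (hπ : Continuous π) (hr : Continuous r)
    (hinj : InjOn r (π ⁻¹' {OnePoint.infty})) {F : Fin (k + 1) → Set Z}
    (hF : IsClosedTuple (boundarySimplex k) F) :
    ∃ G : Fin (k + 1) → Set X, IsClosedTuple (boundarySimplex k) G ∧
      ∀ z, π z = OnePoint.infty → ∀ i, z ∈ F i → r z ∈ G i :=
  ⟨_, (hF.preimage continuous_subtype_val).image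
    (isClosedEmbedding_restrict_fiber_infty hπ hr hinj),
    fun z hz _ hi => ⟨⟨z, hz⟩, hi, rfl⟩⟩

variable [CompactSpace X]

/-- If the fibre over `∞` has smaller dimension, then it does not contribute: a neighbourhood of the
tuple in that fibre, chosen with closures still forming a tuple, can be enlarged over every `d` to
cover the whole fibre, since `r` maps the latter to a zero-dimensional set. -/
theorem ind_le_of_ind_fiber_infty_lt (hk : 1 ≤ k) (hπ : Continuous π) (hr : Continuous r)
    (hinj : InjOn r (π ⁻¹' {OnePoint.infty}))
    (hcount : ∀ d : D, (r '' (π ⁻¹' {(d : OnePoint D)})).Countable) {α : Ordinal.{u}}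
    (hfib : ∀ d : D, Ind ↥(π ⁻¹' {(d : OnePoint D)}) ≤
      ((α : WithTop Ordinal.{u}) : WithBot (WithTop Ordinal.{u})))
    (hinf : Ind ↥(π ⁻¹' {(OnePoint.infty : OnePoint D)}) <
      ((α : WithTop Ordinal.{u}) : WithBot (WithTop Ordinal.{u}))) :
    Ind Z ≤ ((α : WithTop Ordinal.{u}) : WithBot (WithTop Ordinal.{u})) := by
  refine (ind_le_coe_iff _ α Z).2 fun F hF => ?_
  obtain ⟨G, hG, hFG⟩ := isClosedTuple_image_fiber_infty hπ hr hinj hF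
  obtain ⟨V, hVo, hGV, hVc⟩ := hG.exists_nhd_closure
  have hsel : ∀ d : D, ∃ c : ↥(r '' (π ⁻¹' {(d : OnePoint D)})) → Fin (k + 1),
      IsLocallyConstant c ∧ ∀ t, t.1 ∉ closure (V (c t)) := by
    intro d
    have : Countable ↥(r '' (π ⁻¹' {(d : OnePoint D)})) := hcount d
    have : CompactSpace ↥(r '' (π ⁻¹' {(d : OnePoint D)})) := isCompact_iff_compactSpace.1
      ((isClosed_singleton.preimage hπ).isCompact.image hr)
    obtain ⟨c, hc, hc'⟩ := exists_isLocallyConstant_mem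
      (O := fun i => {t : ↥(r '' (π ⁻¹' {(d : OnePoint D)})) | t.1 ∉ closure (V i)})
      (fun i => isClosed_closure.isOpen_compl.preimage continuous_subtype_val) fun t => hVc t
    exact ⟨c, hc, hc'⟩
  choose c hc hcV using hsel
  have hne : ∀ i : Fin (k + 1), i + 1 ≠ i := by
    obtain ⟨n, rfl⟩ : ∃ n, k = n + 1 := ⟨k - 1, by omega⟩
    intro i
    simp
  -- points over `d` avoiding the closure of `V i` are added to the next member `V (i + 1)`
  let T : D → Fin (k + 1) → Set Z := fun d i => (↑) ''
    {z : ↥(π ⁻¹' {(d : OnePoint D)}) | c d ⟨r z, mem_image_of_mem r z.2⟩ + 1 = i}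
  let W : Fin (k + 1) → Set Z := fun i => r ⁻¹' V i ∪ ⋃ d, T d i
  have hT : ∀ {d d' : D} {z : Z} (hz : π z = d) {i}, z ∈ T d' i →
      c d ⟨r z, mem_image_of_mem r hz⟩ + 1 = i := by
    rintro d d' z hz i ⟨⟨y, hy⟩, h, rfl⟩
    obtain rfl : d' = d := OnePoint.coe_injective (hy.symm.trans hz)
    exact h
  have hWinf : ∀ z, π z = OnePoint.infty → ∀ i, z ∈ W i ↔ r z ∈ V i := by
    refine fun z hz i => ⟨?_, Or.inl⟩
    rintro (h | h)
    · exact h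
    · obtain ⟨d, ⟨y, hy⟩, -, rfl⟩ := mem_iUnion.1 h
      exact absurd (hy.symm.trans hz) (OnePoint.coe_ne_infty d)
  have hW : IsOpenTuple (boundarySimplex k) W := by
    refine ⟨isTuple_boundarySimplex_iff.2 fun z => ?_, fun i => ?_⟩
    · cases hz : π z with
      | infty =>
        obtain ⟨i, hi⟩ := hVc (r z)
        exact ⟨i, fun h => hi (subset_closure ((hWinf z hz i).1 h))⟩
      | coe d =>
        refine ⟨c d ⟨r z, mem_image_of_mem r hz⟩, ?_⟩
        rintro (h | h)
        · exact hcV d _ (subset_closure h)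
        · obtain ⟨d', h⟩ := mem_iUnion.1 h
          exact hne _ (hT hz h)
    · refine ((hVo i).preimage hr).union (isOpen_iUnion fun d => ?_)
      refine ((isOpen_singleton_coe_onePoint d).preimage hπ).isOpenMap_subtype_val _ ?_
      have := hc d {j | j + 1 = i}
      exact this.preimage (by fun_prop)
  obtain ⟨U, hU, E, hE, hoff, hon⟩ := exists_nhd_eq_off_finite hπ hfib hF hW
    fun z hz i hi => Or.inl (hGV i (hFG z hz i hi))
  refine ⟨U, hU, ?_⟩
  have hQ : IsClosed (partitionOf U) := (isOpen_iUnion fun i => hU.1.2 i).isClosed_compl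
  have hmem : ∀ z ∈ partitionOf U, ∀ d : D, π z = d → d ∈ E := by
    intro z hz d hd
    by_contra hdE
    have hz' : ∀ d' ∈ E, π z ≠ d' := by
      intro d' hd' h
      exact hdE (OnePoint.coe_injective (hd.symm.trans h) ▸ hd')
    refine hz (mem_iUnion.2 ⟨c d ⟨r z, mem_image_of_mem r hd⟩ + 1, (hoff z hz' _).2 ?_⟩)
    exact Or.inr (mem_iUnion.2 ⟨d, ⟨z, hd⟩, rfl, rfl⟩)
  have hfin : (range fun z : ↥(partitionOf U) => π z).Finite := by
    refine ((hE.image ((↑) : D → OnePoint D)).insert OnePoint.infty).subset ?_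
    rintro _ ⟨z, rfl⟩
    dsimp only
    cases hz : π z with
    | infty => exact mem_insert _ _
    | coe d => exact mem_insert_of_mem _ ⟨d, hmem z z.2 d hz, rfl⟩
  have : Finite (range fun z : ↥(partitionOf U) => π z) := hfin
  have hloc : IsLocallyConstant (rangeFactorization fun z : ↥(partitionOf U) => π z) := by
    refine IsLocallyConstant.iff_continuous _ |>.2 ?_
    exact (hπ.comp continuous_subtype_val).subtype_mk _
  refine ind_lt_of_isLocallyConstant hloc (WithBot.bot_lt_coe _) fun ⟨p, hp⟩ => ?_
  have hpre : (rangeFactorization fun z : ↥(partitionOf U) => π z) ⁻¹' {⟨p, hp⟩} =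
      (↑) ⁻¹' (π ⁻¹' {p}) := by
    ext z
    exact Subtype.ext_iff
  rw [hpre]
  have hemb : Ind ↥((↑) ⁻¹' (π ⁻¹' {p}) : Set ↥(partitionOf U)) ≤
      Ind ↥(partitionOf U ∩ π ⁻¹' {p}) := by
    refine (Homeomorph.ind_eq
      { toFun := fun z => ⟨z.1.1, z.1.2, z.2⟩
        invFun := fun z => ⟨⟨z.1, z.2.1⟩, z.2.2⟩
        left_inv := fun _ => rfl
        right_inv := fun _ => rfl
        continuous_toFun := by fun_prop
        continuous_invFun := by fun_prop }).le
  refine hemb.trans_lt ?_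
  have hcl : IsClosed (partitionOf U ∩ π ⁻¹' {p}) := hQ.inter (isClosed_singleton.preimage hπ)
  induction p with
  | infty => exact (ind_mono_of_isClosed hcl inter_subset_right).trans_lt hinf
  | coe d =>
    obtain ⟨z, hz⟩ := hp
    exact hon d (hmem z z.2 d hz)

/-- The dimension exceeds that of `X` and of the fibres over the isolated points by at most one. -/
theorem ind_le_add_one (hk : 1 ≤ k) (hπ : Continuous π) (hr : Continuous r)
    (hinj : InjOn r (π ⁻¹' {OnePoint.infty}))
    (hcount : ∀ d : D, (r '' (π ⁻¹' {(d : OnePoint D)})).Countable) {α : Ordinal.{u}}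
    (hfib : ∀ d : D, Ind ↥(π ⁻¹' {(d : OnePoint D)}) ≤
      ((α : WithTop Ordinal.{u}) : WithBot (WithTop Ordinal.{u})))
    (hX : Ind X ≤ ((α : WithTop Ordinal.{u}) : WithBot (WithTop Ordinal.{u}))) :
    Ind Z ≤ (((Order.succ α : Ordinal.{u}) : WithTop Ordinal.{u}) : WithBot (WithTop Ordinal.{u})) := by
  have hsucc : ((α : WithTop Ordinal.{u}) : WithBot (WithTop Ordinal.{u})) <
      (((Order.succ α : Ordinal.{u}) : WithTop Ordinal.{u}) : WithBot (WithTop Ordinal.{u})) :=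
    WithBot.coe_lt_coe.2 (WithTop.coe_lt_coe.2 (Order.lt_succ α))
  refine (ind_le_coe_iff _ (Order.succ α) Z).2 fun F hF => ?_
  obtain ⟨G, hG, hFG⟩ := isClosedTuple_image_fiber_infty hπ hr hinj hF
  obtain ⟨V, hV, hP⟩ := (ind_le_coe_iff _ α X).1 hX G hG
  have hVr := hV.preimage hr
  obtain ⟨U, hU, E, -, hoff, -⟩ := exists_nhd_eq_off_finite hπ hfib hF hVr.1
    fun z hz i hi => hV.2 i (hFG z hz i hi)
  refine ⟨U, hU, lt_of_le_of_lt ?_ hsucc⟩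
  have hQ : IsClosed (partitionOf U) := (isOpen_iUnion fun i => hU.1.2 i).isClosed_compl
  have : CompactSpace ↥(partitionOf U) := isCompact_iff_compactSpace.1 hQ.isCompact
  have hsub : ∀ p, Ind ↥((fun z : ↥(partitionOf U) => π z) ⁻¹' {p}) ≤ Ind ↥(π ⁻¹' {p}) := by
    intro p
    exact (hQ.isClosedEmbedding_subtypeVal.restrictPreimage (π ⁻¹' {p})).ind_le
  refine ind_le_of_ind_fiber_infty_lt hk (π := fun z : ↥(partitionOf U) => π z)
    (r := fun z => r z) (by fun_prop) (by fun_prop) ?_ ?_ (fun d => (hsub d).trans (hfib d)) ?_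
  · exact fun z hz z' hz' h => Subtype.ext (hinj hz hz' h)
  · refine fun d => (hcount d).mono ?_
    rintro _ ⟨z, hz, rfl⟩
    exact ⟨z, hz, rfl⟩
  · refine lt_of_le_of_lt ?_ hP
    have hm : ∀ z : ↥((fun z : ↥(partitionOf U) => π z) ⁻¹' {OnePoint.infty}),
        r z ∈ partitionOf V := by
      rintro ⟨⟨z, hz⟩, hz'⟩
      have h : ∀ d ∈ E, π z ≠ d := fun d _ hd =>
        OnePoint.coe_ne_infty d (hd.symm.trans hz')
      simpa [partitionOf, hoff z h] using hz
    have : CompactSpace ↥((fun z : ↥(partitionOf U) => π z) ⁻¹' {OnePoint.infty}) :=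
      isCompact_iff_compactSpace.1 (isClosed_singleton.preimage (by fun_prop)).isCompact
    refine (Continuous.isClosedEmbedding (f := fun z :
      ↥((fun z : ↥(partitionOf U) => π z) ⁻¹' {OnePoint.infty}) => (⟨r z, hm z⟩ : ↥(partitionOf V)))
      (by fun_prop) fun z z' h => ?_).ind_le
    exact Subtype.ext (Subtype.ext (hinj z.2 z'.2 (congrArg Subtype.val h)))

end UpperBound
/-! ### The lower bound at an obstruction point -/

section LowerBound

open Filter

theorem insert_range_mem_smallSets {X : Type u} [TopologicalSpace X] [T2Space X] {N : Type*}
    [Countable N] {v : N → X} {x : X} (hv : Tendsto v cofinite (𝓝 x)) :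
    insert x (range v) ∈ smallSets X := by
  classical
  by_cases hfin : (insert x (range v)).Finite
  · exact Or.inl hfin
  right
  let A : Set X := range v \ {x}
  have hA : A.Infinite := by
    intro hA
    refine hfin ((hA.insert x).subset ?_)
    rintro y (rfl | hy)
    · exact mem_insert _ _
    · by_cases hyx : y = x
      · exact Or.inl hyx
      · exact Or.inr ⟨hy, hyx⟩
  have : Infinite A := hA.to_subtype
  have : Countable A := ((countable_range v).mono sdiff_subset).to_subtype
  obtain ⟨e⟩ := nonempty_equiv_of_countable (α := ℕ) (β := A)
  let g : OnePoint ℕ → ↥(insert x (range v)) := fun p =>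
    p.elim ⟨x, mem_insert _ _⟩ fun n => ⟨e n, Or.inr (e n).2.1⟩
  have hg : Continuous g := by
    rw [OnePoint.continuous_iff_from_discrete, tendsto_subtype_rng]
    intro O hO
    have h1 : {i | v i ∉ O}.Finite := hv hO
    have h2 : ((fun n => (e n : X)) ⁻¹' (v '' {i | v i ∉ O})).Finite :=
      (h1.image v).preimage (Subtype.val_injective.comp e.injective).injOn
    refine h2.subset fun n hn => ?_
    obtain ⟨i, hi⟩ := (e n).2.1
    exact ⟨i, fun hiO => hn (show (e n : X) ∈ O from hi ▸ hiO), hi⟩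
  have hbij : Function.Bijective g := by
    constructor
    · intro p q hpq
      have hpq' := congrArg Subtype.val hpq
      induction p with
      | infty =>
        induction q with
        | infty => rfl
        | coe n => exact absurd hpq'.symm (e n).2.2
      | coe m =>
        induction q with
        | infty => exact absurd hpq' (e m).2.2
        | coe n => exact congrArg _ (e.injective (Subtype.ext hpq'))
    · rintro ⟨y, hy⟩
      by_cases hyx : y = x
      · exact ⟨OnePoint.infty, Subtype.ext hyx.symm⟩
      · refine ⟨(e.symm ⟨y, hy.resolve_left hyx, hyx⟩ : ℕ), Subtype.ext ?_⟩
        exact congrArg (fun a : A => (a : X)) (e.apply_symm_apply ⟨y, hy.resolve_left hyx, hyx⟩)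
  exact ⟨(hg.homeoOfEquivCompactToT2 (f := Equiv.ofBijective g hbij)).symm⟩

theorem aleph0_le_weight {X : Type u} [TopologicalSpace X] [T0Space X] [Infinite X] :
    ℵ₀ ≤ weight X := by
  refine le_csInf ⟨_, _, TopologicalSpace.isTopologicalBasis_opens, rfl⟩ ?_
  rintro _ ⟨B, hB, rfl⟩
  by_contra! hlt
  have : Finite B := Cardinal.mk_lt_aleph0_iff.1 hlt
  refine Infinite.not_finite (α := X) (Finite.of_injective (fun x => {b : B | x ∈ b.1}) ?_)
  intro x y hxy
  refine (hB.inseparable_iff.2 fun b hb => ?_).eq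
  exact Set.ext_iff.1 hxy ⟨b, hb⟩

variable {k : ℕ} {X Y Z D : Type u} [TopologicalSpace X] [TopologicalSpace Y] [TopologicalSpace Z]
  [CompactSpace Z] [TopologicalSpace D] [DiscreteTopology D]
  {π : Z → OnePoint D} {r : Z → X} {s : X → Z}

local notation "Ind" => ind (boundarySimplex k)

/-- Over an obstruction point `x` of the trace of a neighbourhood on the fibre over `∞`, some layer
contains a copy of `Y` disjoint from the neighbourhood: choose sequences converging to `x` inside
all members but one and a layer `φ d × Y` where `φ d` consists of these sequences and `x`; all but
countably many such `d` have the sequences, times `Y`, inside the corresponding members. -/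
theorem not_ind_le_of_strength_eq_one [T2Space X] [FrechetUrysohnSpace X] (hk : 1 ≤ k)
    (hπ : Continuous π) (hr : Continuous r) (hs : Continuous s)
    (hπs : ∀ x, π (s x) = OnePoint.infty) (hrs : ∀ x, r (s x) = x)
    (hsr : ∀ z, π z = OnePoint.infty → s (r z) = z) (φ : D → ↥(smallSets X))
    (h : ∀ d, ↥(φ d : Set X) × Y → Z) (hh : ∀ d, IsClosedEmbedding (h d))
    (hπh : ∀ d p, π (h d p) = d) (hrh : ∀ d p, r (h d p) = p.1)
    (hφ : Infinite X → ∀ S, ¬ (φ ⁻¹' {S}).Countable)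
    (hstr : strength (boundarySimplex k) X = 1) {α : Ordinal.{u}}
    (hX : Ind X = ((α : WithTop Ordinal.{u}) : WithBot (WithTop Ordinal.{u})))
    (hY : ((α : WithTop Ordinal.{u}) : WithBot (WithTop Ordinal.{u})) ≤ Ind Y) :
    ¬ Ind Z ≤ ((α : WithTop Ordinal.{u}) : WithBot (WithTop Ordinal.{u})) := by
  intro hZ
  unfold strength at hstr
  split_ifs at hstr with hc
  obtain ⟨-, -, hc⟩ := hc
  push Not at hc
  obtain ⟨F, hF, hobs⟩ := hc
  have hsemb : IsClosedEmbedding s := by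
    refine ⟨.of_leftInverse hrs hr hs, ?_⟩
    convert (isClosed_singleton (x := (OnePoint.infty : OnePoint D))).preimage hπ using 1
    ext z
    exact ⟨fun ⟨x, hx⟩ => hx ▸ hπs x, fun hz => ⟨r z, hsr z hz⟩⟩
  obtain ⟨U, hU, hP⟩ := (ind_le_coe_iff _ α Z).1 hZ _ (hF.image hsemb)
  have hQ : IsClosed (partitionOf U) := (isOpen_iUnion fun i => hU.1.2 i).isClosed_compl
  have hUt := isTuple_boundarySimplex_iff.1 hU.1.1
  have hV := hU.preimage hs
  obtain ⟨x, hx⟩ : (obstruction (boundarySimplex k) fun i => s ⁻¹' U i).Nonempty := by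
    by_contra hne
    refine absurd (hobs _ ⟨hV.1, fun i => (subset_preimage_image s _).trans (hV.2 i)⟩
      (not_nonempty_iff_eq_empty.1 hne)) (not_le.2 ?_)
    rw [hX]
    have he : partitionOf (fun i => s ⁻¹' U i) = s ⁻¹' partitionOf U := by
      ext; simp [partitionOf]
    rw [he]
    exact (hsemb.restrictPreimage (partitionOf U)).ind_le.trans_lt hP
  have hcl := mem_closure_of_mem_obstruction hV.1.2 hV.1.1 hx
  choose v hv hvx using fun i => mem_closure_iff_seq_limit.1 (hcl i)
  let w : Fin (k + 1) × ℕ → X := fun q => v q.1 q.2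
  have hw : Tendsto w cofinite (𝓝 x) := by
    intro O hO
    have : (⋃ i, (fun n => (i, n)) '' {n | v i n ∉ O}).Finite :=
      finite_iUnion fun i => Set.Finite.image _
        (by simpa [Nat.cofinite_eq_atTop] using (Nat.cofinite_eq_atTop ▸ hvx i) hO)
    refine this.subset fun q hq => ?_
    exact mem_iUnion.2 ⟨q.1, q.2, hq, rfl⟩
  let S : ↥(smallSets X) := ⟨_, insert_range_mem_smallSets hw⟩
  -- in a finite, hence discrete, space the closures add nothing, so `x` would lie in every member
  have hinf : Infinite X := by
    by_contra hfin
    have : Finite X := not_infinite_iff_finite.1 hfin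
    have hmem : ∀ i j, j ≠ i → s x ∈ U j := by
      intro i j hj
      have := hcl i
      rw [(toFinite _).isClosed.closure_eq] at this
      exact this j hj
    obtain ⟨j, hj⟩ := hUt (s x)
    obtain ⟨n, rfl⟩ : ∃ n, k = n + 1 := ⟨k - 1, by omega⟩
    obtain ⟨i, hi⟩ := exists_ne j
    exact hj (hmem i j hi.symm)
  let bad : Set D := ⋃ (q : Fin (k + 1) × ℕ) (j : Fin (k + 1)) (_ : j ≠ q.1),
    {d | ∃ z ∈ r ⁻¹' {w q} ∩ (U j)ᶜ, π z = d}
  have hbad : bad.Countable := by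
    refine countable_iUnion fun q => countable_iUnion fun j => countable_iUnion fun hj => ?_
    refine (finite_setOf_coe_mem_image hπ ((isClosed_singleton.preimage hr).inter
      (hU.1.2 j).isClosed_compl) ?_).countable
    rintro z ⟨hz, hzU⟩ hz'
    refine hzU ?_
    rw [← hsr z hz', show r z = w q from hz]
    exact hv q.1 q.2 j hj
  obtain ⟨d, hdS, hd⟩ : ∃ d, φ d = S ∧ d ∉ bad := by
    by_contra! hall
    exact hφ hinf S (hbad.mono fun d hd => hall d hd)
  have hxd : x ∈ (φ d : Set X) := by
    rw [hdS]
    exact mem_insert _ _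
  have hwd : ∀ q, w q ∈ (φ d : Set X) := by
    rw [hdS]
    exact fun q => mem_insert_of_mem _ ⟨q, rfl⟩
  have hgood : ∀ q j, j ≠ q.1 → ∀ y, h d (⟨w q, hwd q⟩, y) ∈ U j := by
    intro q j hj y
    by_contra hz
    exact hd (mem_iUnion.2 ⟨q, mem_iUnion.2 ⟨j, mem_iUnion.2 ⟨hj, _, ⟨hrh d _, hz⟩, hπh d _⟩⟩⟩)
  have hcopy : ∀ y, h d (⟨x, hxd⟩, y) ∈ partitionOf U := by
    intro y hy
    obtain ⟨i, hi⟩ := mem_iUnion.1 hy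
    have hlim : Tendsto (fun n => h d (⟨w (i, n), hwd (i, n)⟩, y)) atTop
        (𝓝 (h d (⟨x, hxd⟩, y))) := by
      refine ((hh d).continuous.tendsto _).comp (Tendsto.prodMk_nhds ?_ tendsto_const_nhds)
      exact tendsto_subtype_rng.2 (hvx i)
    obtain ⟨n, hn⟩ := (hlim.eventually ((hU.1.2 i).mem_nhds hi)).exists
    obtain ⟨j, hj⟩ := hUt (h d (⟨w (i, n), hwd (i, n)⟩, y))
    by_cases hji : j = i
    · exact hj (hji ▸ hn)
    · exact hj (hgood (i, n) j hji y)
  have hYemb : IsClosedEmbedding fun y : Y => h d (⟨x, hxd⟩, y) := by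
    refine ⟨(hh d).isEmbedding.comp (isEmbedding_prodMkRight _), ?_⟩
    convert (hh d).isClosedMap _ ((isClosed_singleton (x := (⟨x, hxd⟩ : ↥(φ d : Set X)))).preimage
      (continuous_fst (Y := Y))) using 1
    ext z
    constructor
    · rintro ⟨y, rfl⟩
      exact ⟨_, rfl, rfl⟩
    · rintro ⟨⟨_, y⟩, rfl, rfl⟩
      exact ⟨y, rfl⟩
  refine absurd (hY.trans (hYemb.isEmbedding.toHomeomorph.ind_eq.le.trans
    (ind_mono_of_isClosed hYemb.isClosed_range ?_))) (not_le.2 hP)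
  rintro _ ⟨y, rfl⟩
  exact hcopy y

end LowerBound
/-! ### The plank -/

section Plank

variable {D X Y : Type u}

/-- The quotient makes no identifications over the isolated points of `OnePoint D`. -/
theorem Plank.mk_eq_mk_coe_iff {d : D} {x : X} {y : Y} {p : OnePoint D × X × Y} :
    Quotient.mk (plankSetoid D X Y) p = Quotient.mk _ ((d : OnePoint D), x, y) ↔
      p = ((d : OnePoint D), x, y) := by
  refine ⟨fun h => ?_, fun h => h ▸ rfl⟩
  rcases Quotient.exact h with h | ⟨-, h, -⟩
  · exact h
  · exact absurd h (OnePoint.coe_ne_infty d)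

variable [TopologicalSpace X] {φ : D → ↥(smallSets X)}

theorem countable_of_mem_smallSets {S : Set X} (hS : S ∈ smallSets X) : S.Countable := by
  rcases hS with h | ⟨⟨e⟩⟩
  · exact h.countable
  · have : Countable (OnePoint ℕ) := inferInstanceAs (Countable (Option ℕ))
    exact e.injective.countable

theorem isCompact_of_mem_smallSets {S : Set X} (hS : S ∈ smallSets X) : IsCompact S := by
  rcases hS with h | ⟨⟨e⟩⟩
  · exact h.isCompact
  · exact isCompact_iff_compactSpace.2 e.symm.compactSpace

namespace Plank

/-- The index of the layer containing a point of the plank. -/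
def index (z : Plank Y φ) : OnePoint D :=
  Quotient.lift (s := plankSetoid D X Y) (fun p => p.1)
    (by rintro p q (rfl | ⟨hp, hq, -⟩); exacts [rfl, hp.trans hq.symm]) z.1

/-- The retraction of the plank onto its layer over `∞`, a copy of `X`. -/
def proj (z : Plank Y φ) : X :=
  Quotient.lift (s := plankSetoid D X Y) (fun p => p.2.1)
    (by rintro p q (rfl | ⟨-, -, h⟩); exacts [rfl, h]) z.1

variable (φ) in
/-- The layer over `∞`, parametrized by `X`; the choice of `y` does not matter. -/
def base (y : Y) (x : X) : Plank Y φ :=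
  ⟨Quotient.mk _ (OnePoint.infty, x, y), mem_iUnion.2 ⟨OnePoint.infty, _, rfl, rfl⟩⟩

variable (φ) in
/-- The layer over `d`, parametrized by `φ d × Y`. -/
def fiber (d : D) (p : ↥(φ d : Set X) × Y) : Plank Y φ :=
  ⟨Quotient.mk _ ((d : OnePoint D), p.1.1, p.2),
    mem_iUnion.2 ⟨(d : OnePoint D), _, ⟨rfl, p.1.2⟩, rfl⟩⟩

theorem base_proj (y : Y) (z : Plank Y φ) (hz : index z = OnePoint.infty) :
    base φ y (proj z) = z := by
  obtain ⟨⟨p⟩, hp⟩ := z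
  exact Subtype.ext (Quotient.sound (Or.inr ⟨rfl, hz, rfl⟩))

theorem range_fiber (d : D) : range (fiber (Y := Y) φ d) = index ⁻¹' {(d : OnePoint D)} := by
  ext z
  constructor
  · rintro ⟨p, rfl⟩
    rfl
  · intro hz
    obtain ⟨q, hq⟩ := z
    obtain ⟨a, ha⟩ := mem_iUnion.1 hq
    induction a with
    | infty =>
      obtain ⟨p, hp, rfl⟩ := ha
      exact absurd (hz.symm.trans hp) (OnePoint.coe_ne_infty d)
    | coe e =>
      obtain ⟨⟨b, x, y⟩, ⟨rfl, hx⟩, rfl⟩ := ha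
      obtain rfl : e = d := OnePoint.coe_injective hz
      exact ⟨(⟨x, hx⟩, y), rfl⟩

variable [TopologicalSpace D] [TopologicalSpace Y]

theorem continuous_index : Continuous (index : Plank Y φ → OnePoint D) :=
  (continuous_fst.quotient_lift _).comp continuous_subtype_val

theorem continuous_proj : Continuous (proj : Plank Y φ → X) :=
  ((continuous_fst.comp continuous_snd).quotient_lift _).comp continuous_subtype_val

theorem continuous_base (y : Y) : Continuous (base φ y) :=
  (continuous_quotient_mk'.comp (by fun_prop)).subtype_mk _

theorem continuous_fiber (d : D) : Continuous (fiber (Y := Y) φ d) :=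
  (continuous_quotient_mk'.comp (by fun_prop)).subtype_mk _

theorem isClosedEmbedding_fiber [T2Space X] [DiscreteTopology D] (d : D) :
    IsClosedEmbedding (fiber (Y := Y) φ d) := by
  refine .of_continuous_injective_isClosedMap (continuous_fiber d) ?_ ?_
  · rintro ⟨⟨x, hx⟩, y⟩ ⟨⟨x', hx'⟩, y'⟩ h
    have := mk_eq_mk_coe_iff.1 (congrArg Subtype.val h)
    simp only [Prod.mk.injEq, true_and] at this
    obtain ⟨rfl, rfl⟩ := this
    rfl
  · intro C hC
    let ι : ↥(φ d : Set X) × Y → OnePoint D × X × Y := fun p => ((d : OnePoint D), p.1.1, p.2)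
    have hS : IsClosed (φ d : Set X) := (isCompact_of_mem_smallSets (φ d).2).isClosed
    have hι : IsClosedMap ι := by
      have h1 : IsClosedEmbedding (Prod.map Subtype.val id : ↥(φ d : Set X) × Y → X × Y) :=
        hS.isClosedEmbedding_subtypeVal.prodMap .id
      have h2 : IsClosedMap (Prod.mk (d : OnePoint D) : X × Y → OnePoint D × X × Y) := by
        refine (isEmbedding_prodMkRight (d : OnePoint D)).isInducing.isClosedMap ?_
        convert (isClosed_singleton (x := (d : OnePoint D))).preimage
          (continuous_fst (Y := X × Y)) using 1
        ext ⟨a, q⟩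
        simp [eq_comm]
      exact h2.comp h1.isClosedMap
    have hK : IsClosed (Quotient.mk (plankSetoid D X Y) '' (ι '' C)) := by
      rw [← isQuotientMap_quotient_mk'.isClosed_preimage]
      convert hι C hC using 1
      ext p
      constructor
      · rintro ⟨_, ⟨c, hc, rfl⟩, h⟩
        exact ⟨c, hc, (mk_eq_mk_coe_iff.1 h.symm).symm⟩
      · exact fun hp => ⟨p, hp, rfl⟩
    convert hK.preimage continuous_subtype_val using 1
    ext z
    constructor
    · rintro ⟨p, hp, rfl⟩
      exact ⟨_, ⟨p, hp, rfl⟩, rfl⟩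
    · rintro ⟨_, ⟨p, hp, rfl⟩, h⟩
      exact ⟨p, hp, Subtype.ext h⟩

theorem compactSpace [CompactSpace X] [CompactSpace Y] [T2Space X] [DiscreteTopology D] :
    CompactSpace (Plank Y φ) := by
  have : CompactSpace (PlankQuotient D X Y) := inferInstance
  refine isCompact_iff_compactSpace.1 (IsClosed.isCompact ?_)
  rw [← isQuotientMap_quotient_mk'.isClosed_preimage]
  -- the complement consists of the open sets `{d} × (φ d)ᶜ × Y`
  have h : (Quotient.mk (plankSetoid D X Y) ⁻¹' ⋃ α, layer Y φ α)ᶜ =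
      ⋃ d : D, {(d : OnePoint D)} ×ˢ ((φ d : Set X)ᶜ ×ˢ (univ : Set Y)) := by
    ext ⟨a, x, y⟩
    simp only [mem_compl_iff, mem_preimage, mem_iUnion, mem_prod, mem_singleton_iff, mem_univ,
      and_true]
    constructor
    · intro h
      induction a with
      | infty => exact absurd ⟨OnePoint.infty, _, rfl, rfl⟩ h
      | coe d => exact ⟨d, rfl, fun hx => h ⟨(d : OnePoint D), _, ⟨rfl, hx⟩, rfl⟩⟩
    · rintro ⟨d, rfl, hx⟩ ⟨b, hb⟩
      induction b with
      | infty =>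
        obtain ⟨p, hp, hpq⟩ := hb
        rw [mk_eq_mk_coe_iff] at hpq
        subst hpq
        exact OnePoint.coe_ne_infty d hp
      | coe e =>
        obtain ⟨p, ⟨hp, hpx⟩, hpq⟩ := hb
        rw [mk_eq_mk_coe_iff] at hpq
        subst hpq
        obtain rfl : d = e := OnePoint.coe_injective hp
        exact hx hpx
  rw [← isOpen_compl_iff]
  change IsOpen (Quotient.mk (plankSetoid D X Y) ⁻¹' ⋃ α, layer Y φ α)ᶜ
  rw [h]
  exact isOpen_iUnion fun d => (isOpen_singleton_coe_onePoint d).prod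
    ((isCompact_of_mem_smallSets (φ d).2).isClosed.isOpen_compl.prod isOpen_univ)

theorem ind_fiber_le {k : ℕ} [T2Space X] [CompactSpace X] [CompactSpace Y] [DiscreteTopology D]
    (d : D) : ind (boundarySimplex k) ↥(index (Y := Y) (φ := φ) ⁻¹' {(d : OnePoint D)}) ≤
      ind (boundarySimplex k) Y := by
  have : CompactSpace ↥(φ d : Set X) :=
    isCompact_iff_compactSpace.1 (isCompact_of_mem_smallSets (φ d).2)
  have : Countable ↥(φ d : Set X) := countable_of_mem_smallSets (φ d).2
  rw [← range_fiber]
  exact (isClosedEmbedding_fiber d).isEmbedding.toHomeomorph.ind_eq.ge.trans ind_prod_le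

end Plank

end Plank
end FedorchukDim

theorem mainTheorem6 (k : ℕ) (hk : 1 ≤ k)
    (X Y : Type u) [TopologicalSpace X] [TopologicalSpace Y]
    [CompactSpace X] [T2Space X] [Nonempty X] [CompactSpace Y] [T2Space Y] [Nonempty Y]
    [FrechetUrysohnSpace X]
    (D : Type u) [TopologicalSpace D] [DiscreteTopology D]
    (hD₀ : Cardinal.aleph0 ≤ Cardinal.mk D)
    (hDX : Order.succ (FedorchukDim.weight X) ≤ Cardinal.mk D)
    (hDY : Order.succ (FedorchukDim.weight Y) ≤ Cardinal.mk D)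
    (hDS : Cardinal.mk ↥(FedorchukDim.smallSets X) ≤ Cardinal.mk D)
    (φ : D → ↥(FedorchukDim.smallSets X))
    (hφ : ∀ S : ↥(FedorchukDim.smallSets X), Cardinal.mk ↥(φ ⁻¹' {S}) = Cardinal.mk D)
    (hstr : FedorchukDim.strength (FedorchukDim.boundarySimplex k) X = 1)
    (hXY : FedorchukDim.ind (FedorchukDim.boundarySimplex k) X =
      FedorchukDim.ind (FedorchukDim.boundarySimplex k) Y) :
    FedorchukDim.ind (FedorchukDim.boundarySimplex k) (FedorchukDim.Plank Y φ) =
      FedorchukDim.ind (FedorchukDim.boundarySimplex k) X + 1 := by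
  obtain ⟨α, hα⟩ : ∃ α : Ordinal.{u}, FedorchukDim.ind (FedorchukDim.boundarySimplex k) X =
      ((α : WithTop Ordinal.{u}) : WithBot (WithTop Ordinal.{u})) := by
    have hstr' := hstr
    unfold FedorchukDim.strength at hstr'
    split_ifs at hstr' with hc
    obtain ⟨h0, htop, -⟩ := hc
    rcases h : FedorchukDim.ind (FedorchukDim.boundarySimplex k) X with _ | _ | α
    · exact absurd (h ▸ h0) not_lt_bot
    · exact absurd (h ▸ htop) (lt_irrefl _)
    · exact ⟨α, rfl⟩
  have : CompactSpace (FedorchukDim.Plank Y φ) := FedorchukDim.Plank.compactSpace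
  obtain ⟨y⟩ := ‹Nonempty Y›
  have hle : FedorchukDim.ind (FedorchukDim.boundarySimplex k) (FedorchukDim.Plank Y φ) ≤
      (((Order.succ α : Ordinal.{u}) : WithTop Ordinal.{u}) : WithBot (WithTop Ordinal.{u})) := by
    refine FedorchukDim.ind_le_add_one hk FedorchukDim.Plank.continuous_index
      FedorchukDim.Plank.continuous_proj ?_ (fun d => ?_)
      (fun d => (FedorchukDim.Plank.ind_fiber_le d).trans (hXY.symm.trans hα).le) hα.le
    · intro z hz z' hz' h
      rw [← FedorchukDim.Plank.base_proj y z hz, h, FedorchukDim.Plank.base_proj y z' hz']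
    · refine (FedorchukDim.countable_of_mem_smallSets (φ d).2).mono ?_
      rw [← FedorchukDim.Plank.range_fiber]
      rintro _ ⟨_, ⟨p, rfl⟩, rfl⟩
      exact p.1.2
  have hnle : ¬ FedorchukDim.ind (FedorchukDim.boundarySimplex k) (FedorchukDim.Plank Y φ) ≤
      ((α : WithTop Ordinal.{u}) : WithBot (WithTop Ordinal.{u})) := by
    refine FedorchukDim.not_ind_le_of_strength_eq_one hk FedorchukDim.Plank.continuous_index
      FedorchukDim.Plank.continuous_proj (FedorchukDim.Plank.continuous_base y) (fun _ => rfl)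
      (fun _ => rfl) (FedorchukDim.Plank.base_proj y) φ (FedorchukDim.Plank.fiber φ)
      FedorchukDim.Plank.isClosedEmbedding_fiber (fun _ _ => rfl) (fun _ _ => rfl)
      (fun hinf S hS => ?_) hstr hα (hα.symm.trans hXY).le
    -- the weight of an infinite space is infinite, so `D` and the fibres of `φ` are uncountable
    have h1 := Cardinal.le_aleph0_iff_set_countable.2 hS
    rw [hφ S] at h1
    exact absurd (FedorchukDim.aleph0_le_weight (X := X))
      (not_le.2 ((Order.succ_le_iff.1 hDX).trans_le h1))
  rw [hα]
  rcases h : FedorchukDim.ind (FedorchukDim.boundarySimplex k) (FedorchukDim.Plank Y φ)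
    with _ | _ | β
  · exact absurd (h ▸ bot_le) hnle
  · rw [h] at hle
    exact absurd (WithBot.coe_le_coe.1 hle) (not_le.2 (WithTop.coe_lt_top _))
  · rw [h] at hle hnle
    have h1 : β ≤ Order.succ α := WithTop.coe_le_coe.1 (WithBot.coe_le_coe.1 hle)
    have h2 : α < β := by
      by_contra hc
      exact hnle (WithBot.coe_le_coe.2 (WithTop.coe_le_coe.2 (not_lt.1 hc)))
    obtain rfl : β = Order.succ α := le_antisymm h1 (Order.succ_le_of_lt h2)
    rfl
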